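/- **Setting.** There are $N$ players and $K\ge N$ arms. Each arm $a$ has a known strict preference list over the players. If player $p$ is matched with arm $a$, it receives a reward in $[0,1]$ with unknown law $\mathbb P_{p,a}$ and mean $\mu_{p,a}$; the rewards of a pair in different rounds are independent. For each $p$ the means $\mu_{p,a}$ are pairwise distinct, and $p$ truly prefers arms with larger mean. Let $m^\star_s$ be the player-optimal stable matching for these preferences. **Elimination Algorithm** (input $\delta>0$). Start with $S_p=$ all arms, for every player $p$. In round $t=1,2,\dots$, as long as some $S_p\neq\emptyset$: sample all matchings of a minimal matching cover of $\{(p,a): a\in S_p\}$ (a set of matchings of minimal cardinality covering all these pairs, each exactly once); update the sample means $\hat\mu_{p,a}$, $a\in S_p$; let $\epsilon_t=\sqrt{\ln(4KNt^2/\delta)/(2t)}$ and $C_{p,a}=[\hat\mu_{p,a}-\epsilon_t,\hat\mu_{p,a}+\epsilon_t]$; simultaneously remove from $S_p$ every $a\in S_p$ with $C_{p,a}\cap C_{p,j}=\emptyset$ for all other available arms $j\in S_p\setminus\{a\}$. When all $S_p$ are empty, sort the arms for each player by decreasing $\hat\mu_{p,a}$, and return the result of player-proposing deferred acceptance with these estimated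 preferences and the true preferences of the arms. **Theorem.** The algorithm is $\delta$-PCOS: with probability at least $1-\delta$ it terminates and outputs $m^\star_s$. Let $K\ge 2$ and put, for each pair $(p,a)$, $$\Delta_{p,a}=\min_{a'\ne a}|\mu_{p,a}-\mu_{p,a'}|,\qquad t_{p,a}=\frac{\ln\big(KN/(\delta\,\Delta_{p,a})\big)}{\Delta_{p,a}^2}.$$ For a set $S$ of pairs let $\Delta(G(S))$ be the maximum degree of the bipartite graph with edge set $S$, and let $\mathcal P(S)=\{r\subseteq S:\Delta(G(S))-\Delta(G(S\setminus r))=1\}$. With $S$ the set of all pairs, choose successively, for $i=1,\dots,K$, $$r_i\in\arg\min_{r\in\mathcal P(S\setminus\bigcup_{j<i}r_j)}\ \max_{(p,a)\in r}t_{p,a},$$ where pairs with equal $t_{p,a}$ are compared by an arbitrary strict linear order on the pairs that is fixed in advance. There is a universal constant $C$ (independent of $N$, $K$, $\delta$, the reward laws and the preferences) such that with probability at least $1-\delta$ the algorithm terminates, outputs $m^\star_s$, and has sampled at most $$C\sum_{s=1}^{K}\max_{(p,a)\in r_s}t_{p,a}$$ matchings in total. -/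

import Mathlib

open MeasureTheory ProbabilityTheory

/-! ### Two-sided markets

Players are `Fin N`, arms are `Fin K`.  A preference list over `n` agents is a permutation `π` of
`Fin n`; `π i` is the agent in position `i` (position `0` is the favourite). -/

/-- A (player, arm) pair. -/
abbrev MarketPair (N K : ℕ) := Fin N × Fin K

/-- `Prefers π x y`: the agent with preference list `π` strictly prefers `x` to `y`. -/
def Prefers {n : ℕ} (π : Equiv.Perm (Fin n)) (x y : Fin n) : Prop := π.symm x < π.symm y

instance {n : ℕ} (π : Equiv.Perm (Fin n)) (x y : Fin n) : Decidable (Prefers π x y) :=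
  inferInstanceAs (Decidable (π.symm x < π.symm y))

/-- A matching: a set of pairwise disjoint player-arm pairs. -/
def IsMatching {N K : ℕ} (m : Finset (MarketPair N K)) : Prop :=
  ∀ x ∈ m, ∀ y ∈ m, x ≠ y → x.1 ≠ y.1 ∧ x.2 ≠ y.2

/-- `(p, a)` is a blocking pair of `m`: it is not in `m`, `p` is unmatched or prefers `a` to its
partner, and `a` is unmatched or prefers `p` to its partner. -/
def IsBlockingPair {N K : ℕ} (π : Fin N → Equiv.Perm (Fin K)) (ρ : Fin K → Equiv.Perm (Fin N))
    (m : Finset (MarketPair N K)) (p : Fin N) (a : Fin K) : Prop :=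
  (p, a) ∉ m ∧ (∀ b, (p, b) ∈ m → Prefers (π p) a b) ∧ (∀ q, (q, a) ∈ m → Prefers (ρ a) p q)

/-- Stable matchings. -/
def IsStable {N K : ℕ} (π : Fin N → Equiv.Perm (Fin K)) (ρ : Fin K → Equiv.Perm (Fin N))
    (m : Finset (MarketPair N K)) : Prop :=
  IsMatching m ∧ ∀ p a, ¬ IsBlockingPair π ρ m p a

/-- `m` is the player-optimal stable matching: it is stable, and each player is matched in `m` at
least as well as in any other stable matching. -/
def IsPlayerOptimalStable {N K : ℕ} (π : Fin N → Equiv.Perm (Fin K))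
    (ρ : Fin K → Equiv.Perm (Fin N)) (m : Finset (MarketPair N K)) : Prop :=
  IsStable π ρ m ∧
    ∀ m', IsStable π ρ m' → ∀ p a', (p, a') ∈ m' → ∃ a, (p, a) ∈ m ∧ (a = a' ∨ Prefers (π p) a a')

/-! ### The deferred acceptance algorithm (players propose) -/

/-- Given the set `R` of rejections so far, each player proposes to its favourite arm among those
that have not rejected it. -/
def daProposals {N K : ℕ} (π : Fin N → Equiv.Perm (Fin K)) (R : Finset (MarketPair N K)) :
    Finset (MarketPair N K) :=
  Finset.univ.filter fun x => x ∉ R ∧ ∀ b, Prefers (π x.1) b x.2 → (x.1, b) ∈ R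

/-- Each arm keeps its favourite proposer and rejects the others. -/
def daStep {N K : ℕ} (π : Fin N → Equiv.Perm (Fin K)) (ρ : Fin K → Equiv.Perm (Fin N))
    (R : Finset (MarketPair N K)) : Finset (MarketPair N K) :=
  R ∪ (daProposals π R).filter fun x => ∃ q, (q, x.2) ∈ daProposals π R ∧ Prefers (ρ x.2) q x.1

/-- Deferred acceptance.  Each step that is not the last one adds a rejection, so that `N * K`
steps suffice; the proposals then held form the output. -/
def deferredAcceptance {N K : ℕ} (π : Fin N → Equiv.Perm (Fin K))
    (ρ : Fin K → Equiv.Perm (Fin N)) : Finset (MarketPair N K) :=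
  daProposals π ((daStep π ρ)^[N * K] ∅)

/-- The preference list that sorts the arms by decreasing value (equal values by index). -/
noncomputable def argsortDesc {K : ℕ} (v : Fin K → ℝ) : Equiv.Perm (Fin K) :=
  Tuple.sort fun a => -v a

/-! ### Matching covers and degrees -/

/-- `M` is a set of matchings that together contain all pairs of `X`. -/
def IsMatchingCover {N K : ℕ} (X : Finset (MarketPair N K))
    (M : Finset (Finset (MarketPair N K))) : Prop :=
  (∀ m ∈ M, IsMatching m) ∧ ∀ x ∈ X, ∃ m ∈ M, x ∈ m

/-- A matching cover of `X` of minimal cardinality which contains each pair of `X` exactly once. -/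
def IsMinimalMatchingCover {N K : ℕ} (X : Finset (MarketPair N K))
    (M : Finset (Finset (MarketPair N K))) : Prop :=
  IsMatchingCover X M ∧ (∀ M', IsMatchingCover X M' → M.card ≤ M'.card) ∧
    ∀ x ∈ X, ∃! m, m ∈ M ∧ x ∈ m

/-- The maximum degree of the bipartite graph on players and arms whose edges are the pairs
in `S`. -/
def maxDegree {N K : ℕ} (S : Finset (MarketPair N K)) : ℕ :=
  max (Finset.univ.sup fun p : Fin N => (S.filter fun x => x.1 = p).card)
    (Finset.univ.sup fun a : Fin K => (S.filter fun x => x.2 = a).card)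

/-- The subsets `r` of `S` whose removal lowers the maximum degree by exactly one. -/
def degreeReducingSets {N K : ℕ} (S : Finset (MarketPair N K)) :
    Set (Finset (MarketPair N K)) :=
  {r | r ⊆ S ∧ maxDegree S = maxDegree (S \ r) + 1}

/-- The pairs that are left after removal of all `r j` with `j < i`. -/
def remainingPairs {N K : ℕ} (r : Fin K → Finset (MarketPair N K)) (i : Fin K) :
    Finset (MarketPair N K) :=
  Finset.univ \ (Finset.univ.filter (· < i)).biUnion r

/-- `r` is a sequence of successive degree-reducing sets: each `r i` minimizes the maximum of `t`
over its elements among all degree-reducing sets of the remaining pairs.  Pairs with equal values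
of `t` are compared by `tie`, i.e. pairs are ordered lexicographically by `(t, tie)`; the last
condition says that the largest pair of `r i` is at most the largest pair of `r'`. -/
def IsDegreeReducingSequence {N K : ℕ} (t : MarketPair N K → ℝ) (tie : MarketPair N K → ℕ)
    (r : Fin K → Finset (MarketPair N K)) : Prop :=
  ∀ i, r i ∈ degreeReducingSets (remainingPairs r i) ∧
    ∀ r' ∈ degreeReducingSets (remainingPairs r i),
      ∃ y ∈ r', ∀ x ∈ r i, toLex (t x, tie x) ≤ toLex (t y, tie y)

/-! ### The elimination algorithm -/

/-- State of the algorithm: the available pairs `{(p, a) | a ∈ S_p}`, the sum and the number of the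
rewards that each player has observed from each arm, and the number of matchings sampled. -/
structure ElimState (N K : ℕ) where
  active : Finset (MarketPair N K)
  rewardSum : Fin N → Fin K → ℝ
  numSamples : Fin N → Fin K → ℕ
  numMatchings : ℕ

/-- Sample means (`0` for a pair without samples). -/
noncomputable def ElimState.estimate {N K : ℕ} (s : ElimState N K) (p : Fin N) (a : Fin K) : ℝ :=
  s.rewardSum p a / s.numSamples p a

/-- The confidence radius of round `t = 1, 2, …`. -/
noncomputable def confRadius (N K : ℕ) (δ : ℝ) (t : ℕ) : ℝ :=
  Real.sqrt (Real.log (4 * K * N * (t : ℝ) ^ 2 / δ) / (2 * t))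

/-- All pairs are available at the start. -/
def elimInit (N K : ℕ) : ElimState N K where
  active := Finset.univ
  rewardSum := fun _ _ => 0
  numSamples := fun _ _ => 0
  numMatchings := 0

/-- Sampling in one round: all matchings of the cover `M` of the available pairs are sampled, and
each available pair, which lies in exactly one of them, gets one new reward `x p a`. -/
noncomputable def elimSample {N K : ℕ} (M : Finset (Finset (MarketPair N K)))
    (x : Fin N → Fin K → ℝ) (s : ElimState N K) : ElimState N K where
  active := s.active
  rewardSum := fun p a => if (p, a) ∈ s.active then s.rewardSum p a + x p a else s.rewardSum p a
  numSamples := fun p a => if (p, a) ∈ s.active then s.numSamples p a + 1 else s.numSamples p a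
  numMatchings := s.numMatchings + M.card

/-- The confidence interval of a pair, given the confidence radius `ε`. -/
noncomputable def ElimState.confInterval {N K : ℕ} (s : ElimState N K) (ε : ℝ) (p : Fin N)
    (a : Fin K) : Set ℝ :=
  Set.Icc (s.estimate p a - ε) (s.estimate p a + ε)

open Classical in
/-- Elimination in one round: simultaneously, every available pair `(p, a)` is removed whose
confidence interval meets that of no other available arm of `p`. -/
noncomputable def elimRemove {N K : ℕ} (ε : ℝ) (s : ElimState N K) : ElimState N K :=
  { s with
    active := s.active.filter fun x =>
      ¬ ∀ j, j ≠ x.2 → (x.1, j) ∈ s.active →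
        s.confInterval ε x.1 x.2 ∩ s.confInterval ε x.1 j = ∅ }

/-- The state after `t` rounds, for the confidence parameter `δ`, the rule `cover` that chooses the
matching cover, and the rewards `x`, where `x t p a` is the reward that player `p` receives from
arm `a` in round `t` if the pair is then sampled.  Nothing changes once no pair is available. -/
noncomputable def elimRun {N K : ℕ} (δ : ℝ)
    (cover : Finset (MarketPair N K) → Finset (Finset (MarketPair N K)))
    (x : ℕ → Fin N → Fin K → ℝ) : ℕ → ElimState N K
  | 0 => elimInit N K
  | t + 1 =>
    let s := elimRun δ cover x t
    if s.active = ∅ then s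
    else elimRemove (confRadius N K δ (t + 1)) (elimSample (cover s.active) (x (t + 1)) s)

/-- The matching returned: deferred acceptance on the estimated preferences. -/
noncomputable def ElimState.output {N K : ℕ} (ρ : Fin K → Equiv.Perm (Fin N))
    (s : ElimState N K) : Finset (MarketPair N K) :=
  deferredAcceptance (fun p => argsortDesc (s.estimate p)) ρ

/-! ### Rewards, gaps and the sample bound of a pair -/

/-- Player `p` receives from arm `a` rewards with law `D p a`, supported in `[0, 1]`; the rewards
of the same pair in different rounds are independent. -/
structure IsRewardProcess {N K : ℕ} {Ω : Type*} [MeasurableSpace Ω] (μ : Measure Ω)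
    (D : Fin N → Fin K → Measure ℝ) (X : ℕ → Fin N → Fin K → Ω → ℝ) : Prop where
  support : ∀ p a, ∀ᵐ x ∂(D p a), x ∈ Set.Icc (0 : ℝ) 1
  measurable : ∀ t p a, Measurable (X t p a)
  law : ∀ t p a, μ.map (X t p a) = D p a
  indep : ∀ p a, iIndepFun (fun t => X t p a) μ

/-- Expected reward of player `p` from arm `a`. -/
noncomputable def meanReward {N K : ℕ} (D : Fin N → Fin K → Measure ℝ) (p : Fin N) (a : Fin K) :
    ℝ :=
  ∫ x, x ∂(D p a)

/-- `Δ_{p,a}`, the smallest difference between the expected reward of `p` from `a` and from another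
arm. -/
noncomputable def minGap {N K : ℕ} (v : Fin N → Fin K → ℝ) (x : MarketPair N K) : ℝ :=
  ⨅ b : {b : Fin K // b ≠ x.2}, |v x.1 x.2 - v x.1 b|

/-- `t_{p,a} = ln (K N / (δ Δ_{p,a})) / Δ_{p,a} ^ 2`. -/
noncomputable def sampleBound {N K : ℕ} (δ : ℝ) (v : Fin N → Fin K → ℝ) (x : MarketPair N K) : ℝ :=
  Real.log (K * N / (δ * minGap v x)) / minGap v x ^ 2

/-!
By Hoeffding's inequality and a union bound, with probability at least `1 - δ` every average of
rewards lies within its confidence radius `ε_t` of the mean at all times. On this event the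
algorithm behaves deterministically. The interval of an available pair meets that of another arm,
so its gap is at most `4 ε_t`; hence a pair is removed by round `256 t_{p,a}`. An arm is removed
once its average is more than `2 ε_t` away from those of the other available arms, and `ε_t` is
decreasing, so the final estimates order the arms as the means do, and deferred acceptance returns
the player-optimal stable matching.

For the number of matchings, a minimal matching cover has at most as many matchings as the maximum
degree (König; here from Birkhoff's theorem), so one sums the maximum degrees of the sets of
available pairs. The maxima of `t_{p,a}` over `r_1, r_2, …` are nondecreasing: otherwise an exchange
between two consecutive sets would give a better first choice. As each `r_i` lowers the degree by
one, the pairs with `t_{p,a}` above a threshold thus have maximum degree at most the number of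
maxima above it, and summing this count over the rounds gives the sum of the maxima.
-/

/-! ### Matching covers and the maximum degree -/

section Matchings

variable {N K : ℕ}

/-- The pairs of `S` with endpoint `v`, where `v` is a vertex of the bipartite graph on players and
arms. Degrees are cardinalities of these sets, for players and arms alike. -/
def pairsAt (S : Finset (MarketPair N K)) (v : Fin N ⊕ Fin K) : Finset (MarketPair N K) :=
  S.filter fun x => v = .inl x.1 ∨ v = .inr x.2

lemma pairsAt_mono {S T : Finset (MarketPair N K)} (h : S ⊆ T) (v : Fin N ⊕ Fin K) :
    pairsAt S v ⊆ pairsAt T v :=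
  Finset.filter_subset_filter _ h

lemma maxDegree_le_iff {S : Finset (MarketPair N K)} {d : ℕ} :
    maxDegree S ≤ d ↔ ∀ v, (pairsAt S v).card ≤ d := by
  simp [maxDegree, pairsAt, eq_comm]

lemma card_pairsAt_le_maxDegree (S : Finset (MarketPair N K)) (v : Fin N ⊕ Fin K) :
    (pairsAt S v).card ≤ maxDegree S :=
  maxDegree_le_iff.1 le_rfl v

lemma maxDegree_mono {S T : Finset (MarketPair N K)} (h : S ⊆ T) : maxDegree S ≤ maxDegree T :=
  maxDegree_le_iff.2 fun v =>
    (Finset.card_le_card (pairsAt_mono h v)).trans (card_pairsAt_le_maxDegree T v)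

lemma maxDegree_insert_le (x : MarketPair N K) (S : Finset (MarketPair N K)) :
    maxDegree (insert x S) ≤ maxDegree S + 1 := by
  refine maxDegree_le_iff.2 fun v => ?_
  have hsub : pairsAt (insert x S) v ⊆ insert x (pairsAt S v) := by
    intro y
    simp only [pairsAt, Finset.mem_filter, Finset.mem_insert]
    tauto
  calc (pairsAt (insert x S) v).card
      ≤ (pairsAt S v).card + 1 := (Finset.card_le_card hsub).trans (Finset.card_insert_le _ _)
    _ ≤ maxDegree S + 1 := Nat.succ_le_succ (card_pairsAt_le_maxDegree S v)

lemma eq_empty_of_maxDegree_eq_zero {S : Finset (MarketPair N K)} (h : maxDegree S = 0) :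
    S = ∅ := by
  refine Finset.eq_empty_of_forall_notMem fun x hx => ?_
  have hmem : x ∈ pairsAt S (.inl x.1) := by simp [pairsAt, hx]
  have hpos : 0 < (pairsAt S (.inl x.1)).card := Finset.card_pos.2 ⟨x, hmem⟩
  exact (hpos.trans_le (card_pairsAt_le_maxDegree S _)).ne' h

lemma maxDegree_le_max (S : Finset (MarketPair N K)) : maxDegree S ≤ max K N := by
  refine maxDegree_le_iff.2 ?_
  rintro (p | a)
  · have hinj : Set.InjOn Prod.snd (pairsAt S (.inl p) : Set (MarketPair N K)) := by
      rintro ⟨q, b⟩ hq ⟨q', b'⟩ hq' hb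
      simp_all [pairsAt]
    refine le_max_of_le_left ?_
    simpa using Finset.card_le_card_of_injOn Prod.snd (fun _ _ => Finset.mem_univ _) hinj
  · have hinj : Set.InjOn Prod.fst (pairsAt S (.inr a) : Set (MarketPair N K)) := by
      rintro ⟨q, b⟩ hq ⟨q', b'⟩ hq' hb
      simp_all [pairsAt]
    refine le_max_of_le_right ?_
    simpa using Finset.card_le_card_of_injOn Prod.fst (fun _ _ => Finset.mem_univ _) hinj

/-- The transposition of the two endpoints of a pair. -/
def endpointSwap (x : MarketPair N K) : Equiv.Perm (Fin N ⊕ Fin K) :=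
  Equiv.swap (.inl x.1) (.inr x.2)

lemma endpointSwap_apply_eq_self_iff {x : MarketPair N K} {v : Fin N ⊕ Fin K} :
    endpointSwap x v = v ↔ ¬ (v = .inl x.1 ∨ v = .inr x.2) := by
  rcases v with p | a
  · by_cases h : p = x.1 <;> simp [endpointSwap, Equiv.swap_apply_def, h]
  · by_cases h : a = x.2 <;> simp [endpointSwap, Equiv.swap_apply_def, h]

lemma eq_endpoints_of_endpointSwap_apply_eq {x : MarketPair N K} {v w : Fin N ⊕ Fin K}
    (hvw : v ≠ w) (h : endpointSwap x v = w) :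
    (v = .inl x.1 ∧ w = .inr x.2) ∨ (v = .inr x.2 ∧ w = .inl x.1) := by
  have hv : v = .inl x.1 ∨ v = .inr x.2 := by
    by_contra hv
    exact hvw ((endpointSwap_apply_eq_self_iff.2 hv).symm.trans h)
  subst h
  rcases hv with rfl | rfl <;> simp [endpointSwap]

/-- The adjacency matrix of the bipartite graph with edge set `S`, divided by `d`, with a diagonal
that makes it doubly stochastic when `d` bounds the degrees. It is written as an affine combination
of permutation matrices, which makes all row and column sums visibly equal to `1`. -/
noncomputable def degreeMatrix (S : Finset (MarketPair N K)) (d : ℕ) :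
    Matrix (Fin N ⊕ Fin K) (Fin N ⊕ Fin K) ℝ :=
  (1 - (S.card : ℝ) / d) • 1 + (1 / (d : ℝ)) • ∑ x ∈ S, (endpointSwap x).permMatrix ℝ

lemma degreeMatrix_apply (S : Finset (MarketPair N K)) (d : ℕ) (v w : Fin N ⊕ Fin K) :
    degreeMatrix S d v w = (1 - (S.card : ℝ) / d) * (if v = w then 1 else 0) +
      ((S.filter fun x => endpointSwap x v = w).card : ℝ) / d := by
  simp [degreeMatrix, Matrix.one_apply, Matrix.sum_apply, PEquiv.toMatrix_apply, div_eq_inv_mul,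
    Equiv.Perm.permMatrix]

lemma degreeMatrix_apply_self (S : Finset (MarketPair N K)) (d : ℕ) (v : Fin N ⊕ Fin K) :
    degreeMatrix S d v v = 1 - ((pairsAt S v).card : ℝ) / d := by
  have hcard : ((pairsAt S v).card : ℝ) + (S.filter fun x => endpointSwap x v = v).card =
      S.card := by
    simp only [endpointSwap_apply_eq_self_iff]
    exact_mod_cast Finset.card_filter_add_card_filter_not (s := S) fun x =>
      v = .inl x.1 ∨ v = .inr x.2
  rw [degreeMatrix_apply, ← hcard, if_pos rfl]
  ring

lemma degreeMatrix_apply_of_ne (S : Finset (MarketPair N K)) (d : ℕ) {v w : Fin N ⊕ Fin K}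
    (h : v ≠ w) :
    degreeMatrix S d v w = ((S.filter fun x => endpointSwap x v = w).card : ℝ) / d := by
  simp [degreeMatrix_apply, h]

lemma degreeMatrix_mem_doublyStochastic {S : Finset (MarketPair N K)} {d : ℕ} (hd : 0 < d)
    (hS : maxDegree S ≤ d) : degreeMatrix S d ∈ doublyStochastic ℝ (Fin N ⊕ Fin K) := by
  refine mem_doublyStochastic.2 ⟨fun v w => ?_, ?_, ?_⟩
  · rcases eq_or_ne v w with rfl | hvw
    · rw [degreeMatrix_apply_self, sub_nonneg]
      exact div_le_one_of_le₀ (by exact_mod_cast maxDegree_le_iff.1 hS v) d.cast_nonneg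
    · rw [degreeMatrix_apply_of_ne S d hvw]
      positivity
  · have hrow (x : MarketPair N K) : ((endpointSwap x).permMatrix ℝ).mulVec 1 = 1 :=
      mulVec_one_of_mem_doublyStochastic permMatrix_mem_doublyStochastic
    simp only [degreeMatrix, Matrix.add_mulVec, Matrix.smul_mulVec, Matrix.sum_mulVec, hrow,
      Matrix.one_mulVec, Finset.sum_const, ← Nat.cast_smul_eq_nsmul ℝ, smul_smul, ← add_smul]
    rw [one_div_mul_eq_div, sub_add_cancel, one_smul]
  · have hcol (x : MarketPair N K) : Matrix.vecMul 1 ((endpointSwap x).permMatrix ℝ) = 1 :=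
      one_vecMul_of_mem_doublyStochastic permMatrix_mem_doublyStochastic
    simp only [degreeMatrix, Matrix.vecMul_add, Matrix.vecMul_smul, Matrix.vecMul_sum, hcol,
      Matrix.vecMul_one, Finset.sum_const, ← Nat.cast_smul_eq_nsmul ℝ, smul_smul, ← add_smul]
    rw [one_div_mul_eq_div, sub_add_cancel, one_smul]

lemma exists_perm_forall_pos_of_mem_doublyStochastic {R n : Type*} [Field R] [LinearOrder R]
    [IsStrictOrderedRing R] [Fintype n] [DecidableEq n] {M : Matrix n n R}
    (hM : M ∈ doublyStochastic R n) : ∃ σ : Equiv.Perm n, ∀ i, 0 < M i (σ i) := by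
  obtain ⟨w, hw, hw1, rfl⟩ := exists_eq_sum_perm_of_mem_doublyStochastic hM
  obtain ⟨σ, -, hσ⟩ : ∃ σ ∈ Finset.univ, 0 < w σ :=
    Finset.exists_lt_of_sum_lt (f := fun _ => 0) (by simp [hw1])
  refine ⟨σ, fun i => ?_⟩
  rw [Matrix.sum_apply]
  refine Finset.sum_pos' (fun τ _ => ?_) ⟨σ, Finset.mem_univ _, ?_⟩
  · exact mul_nonneg (hw τ) (nonneg_of_mem_doublyStochastic permMatrix_mem_doublyStochastic)
  · simpa [Equiv.Perm.permMatrix, PEquiv.toMatrix_apply] using hσ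

lemma exists_mem_of_degreeMatrix_pos {S : Finset (MarketPair N K)} {d : ℕ} {v w : Fin N ⊕ Fin K}
    (hpos : 0 < degreeMatrix S d v w) (hvw : v ≠ w) :
    ∃ x ∈ S, (v = .inl x.1 ∧ w = .inr x.2) ∨ (v = .inr x.2 ∧ w = .inl x.1) := by
  obtain ⟨x, hx, hswap⟩ : ∃ x ∈ S, endpointSwap x v = w := by
    by_contra! hS
    rw [degreeMatrix_apply_of_ne S d hvw, Finset.filter_eq_empty_iff.2 hS] at hpos
    simp at hpos
  exact ⟨x, hx, eq_endpoints_of_endpointSwap_apply_eq hvw hswap⟩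

lemma degreeMatrix_apply_self_eq_zero {S : Finset (MarketPair N K)} {d : ℕ} {v : Fin N ⊕ Fin K}
    (hd : 0 < d) (hv : (pairsAt S v).card = d) : degreeMatrix S d v v = 0 := by
  rw [degreeMatrix_apply_self, hv, div_self (by positivity), sub_self]

lemma isMatching_filter_perm (S : Finset (MarketPair N K)) (σ : Equiv.Perm (Fin N ⊕ Fin K)) :
    IsMatching (S.filter fun x => σ (.inl x.1) = .inr x.2) := by
  rintro ⟨p, a⟩ hpa ⟨q, b⟩ hqb hne
  rw [Finset.mem_filter] at hpa hqb
  refine ⟨?_, ?_⟩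
  · rintro rfl
    exact hne (Prod.ext rfl (Sum.inr_injective (hpa.2.symm.trans hqb.2)))
  · rintro rfl
    exact hne (Prod.ext (Sum.inl_injective (σ.injective (hpa.2.trans hqb.2.symm))) rfl)

/-- A permutation that is positive on the degree matrix moves every vertex of degree `d` along an
edge, so its edges from players to arms form a matching that covers these vertices. -/
lemma exists_isMatching_nonempty_pairsAt {S : Finset (MarketPair N K)} {d : ℕ} (hd : 0 < d)
    (hS : maxDegree S ≤ d) :
    ∃ m ⊆ S, IsMatching m ∧ ∀ v, (pairsAt S v).card = d → (pairsAt m v).Nonempty := by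
  obtain ⟨σ, hσ⟩ := exists_perm_forall_pos_of_mem_doublyStochastic
    (degreeMatrix_mem_doublyStochastic hd hS)
  refine ⟨_, Finset.filter_subset _ _, isMatching_filter_perm S σ, fun v hv => ?_⟩
  have hmoved (w w' : Fin N ⊕ Fin K) (hw : v = w ∨ v = w') (hpos : 0 < degreeMatrix S d w w') :
      w ≠ w' := by
    rintro rfl
    obtain rfl := hw.elim id id
    exact hpos.ne' (degreeMatrix_apply_self_eq_zero hd hv)
  rcases v with p | a
  · have hpos := hσ (.inl p)
    obtain ⟨x, hx, ⟨hp, hmatched⟩ | ⟨hp, -⟩⟩ :=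
      exists_mem_of_degreeMatrix_pos hpos (hmoved _ _ (.inl rfl) hpos)
    · obtain rfl := Sum.inl_injective hp
      exact ⟨x, by simp [pairsAt, hx, hmatched]⟩
    · cases hp
  · have hpos : 0 < degreeMatrix S d (σ.symm (.inr a)) (.inr a) := by
      simpa using hσ (σ.symm (.inr a))
    obtain ⟨x, hx, ⟨hp, ha⟩ | ⟨-, ha⟩⟩ :=
      exists_mem_of_degreeMatrix_pos hpos (hmoved _ _ (.inr rfl) hpos)
    · exact ⟨x, by simp [pairsAt, hx, ← hp, ha]⟩
    · cases ha

lemma exists_isMatching_maxDegree_sdiff_le {S : Finset (MarketPair N K)} {d : ℕ}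
    (hS : maxDegree S ≤ d + 1) : ∃ m ⊆ S, IsMatching m ∧ maxDegree (S \ m) ≤ d := by
  obtain ⟨m, hmS, hm, hcover⟩ := exists_isMatching_nonempty_pairsAt d.succ_pos hS
  refine ⟨m, hmS, hm, maxDegree_le_iff.2 fun v => ?_⟩
  by_contra! hv
  have hsub : pairsAt (S \ m) v ⊆ pairsAt S v := pairsAt_mono Finset.sdiff_subset v
  have hcard : (pairsAt S v).card ≤ d + 1 := maxDegree_le_iff.1 hS v
  obtain ⟨x, hx⟩ := hcover v (hcard.antisymm (hv.trans_le (Finset.card_le_card hsub)))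
  have hxS : x ∈ pairsAt (S \ m) v := by
    rw [Finset.eq_of_subset_of_card_le hsub (hcard.trans hv)]
    exact pairsAt_mono hmS v hx
  simp_all [pairsAt]

lemma exists_isMatchingCover_card_le {S : Finset (MarketPair N K)} {d : ℕ}
    (hS : maxDegree S ≤ d) : ∃ M, IsMatchingCover S M ∧ M.card ≤ d := by
  induction d generalizing S with
  | zero =>
    obtain rfl := eq_empty_of_maxDegree_eq_zero (Nat.le_zero.1 hS)
    exact ⟨∅, ⟨by simp, by simp⟩, by simp⟩
  | succ d ih =>
    obtain ⟨m, -, hm, hdeg⟩ := exists_isMatching_maxDegree_sdiff_le hS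
    obtain ⟨M, ⟨hM, hcover⟩, hcard⟩ := ih hdeg
    refine ⟨insert m M, ⟨Finset.forall_mem_insert _ _ _ |>.2 ⟨hm, hM⟩, fun x hx => ?_⟩,
      (Finset.card_insert_le m M).trans (Nat.succ_le_succ hcard)⟩
    by_cases hxm : x ∈ m
    · exact ⟨m, Finset.mem_insert_self m M, hxm⟩
    · obtain ⟨m', hm', hx'⟩ := hcover x (Finset.mem_sdiff.2 ⟨hx, hxm⟩)
      exact ⟨m', Finset.mem_insert_of_mem hm', hx'⟩

lemma IsMinimalMatchingCover.card_le_maxDegree {S : Finset (MarketPair N K)}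
    {M : Finset (Finset (MarketPair N K))} (hM : IsMinimalMatchingCover S M) :
    M.card ≤ maxDegree S := by
  obtain ⟨M', hM', hcard⟩ := exists_isMatchingCover_card_le (le_refl (maxDegree S))
  exact (hM.2.1 M' hM').trans hcard

end Matchings

/-! ### Preferences and the optimality of deferred acceptance -/

section Preferences

variable {n : ℕ} {π : Equiv.Perm (Fin n)}

lemma Prefers.trans {x y z : Fin n} (hxy : Prefers π x y) (hyz : Prefers π y z) :
    Prefers π x z :=
  lt_trans (b := π.symm y) hxy hyz

lemma Prefers.irrefl {x : Fin n} : ¬ Prefers π x x :=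
  lt_irrefl (π.symm x)

lemma prefers_trichotomy (π : Equiv.Perm (Fin n)) (x y : Fin n) :
    Prefers π x y ∨ x = y ∨ Prefers π y x :=
  (lt_trichotomy (π.symm x) (π.symm y)).imp_right (Or.imp_left fun h => π.symm.injective h)

lemma exists_favourite (π : Equiv.Perm (Fin n)) {s : Finset (Fin n)} (hs : s.Nonempty) :
    ∃ x ∈ s, ∀ y ∈ s, x = y ∨ Prefers π x y := by
  obtain ⟨x, hx, hmin⟩ := s.exists_min_image π.symm hs
  exact ⟨x, hx, fun y hy => (hmin y hy).eq_or_lt.imp_left fun h => π.symm.injective h⟩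

lemma argsortDesc_congr {v w : Fin n → ℝ} (h : ∀ a b, v a < v b ↔ w a < w b) :
    argsortDesc v = argsortDesc w := by
  have hle (a b : Fin n) : v a ≤ v b ↔ w a ≤ w b := by rw [← not_lt, h, not_lt]
  refine Tuple.eq_sort_iff.2 ⟨fun i j hij => ?_, fun i j hij heq => ?_⟩
  · have hsorted : -v (argsortDesc v i) ≤ -v (argsortDesc v j) :=
      Tuple.monotone_sort (fun a => -v a) hij
    exact neg_le_neg ((hle _ _).1 (neg_le_neg_iff.1 hsorted))
  · have hw : w (argsortDesc v i) = w (argsortDesc v j) := neg_injective heq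
    have hv : v (argsortDesc v i) = v (argsortDesc v j) :=
      le_antisymm ((hle _ _).2 hw.le) ((hle _ _).2 hw.ge)
    exact (Tuple.eq_sort_iff.1 rfl).2 i j hij (congrArg Neg.neg hv)

end Preferences

section DeferredAcceptance

variable {N K : ℕ} {π : Fin N → Equiv.Perm (Fin K)} {ρ : Fin K → Equiv.Perm (Fin N)}
  {R : Finset (MarketPair N K)}

lemma mem_daProposals {p : Fin N} {a : Fin K} :
    (p, a) ∈ daProposals π R ↔ (p, a) ∉ R ∧ ∀ b, Prefers (π p) b a → (p, b) ∈ R := by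
  simp [daProposals]

lemma mem_daStep {p : Fin N} {a : Fin K} :
    (p, a) ∈ daStep π ρ R ↔ (p, a) ∈ R ∨
      ((p, a) ∈ daProposals π R ∧ ∃ q, (q, a) ∈ daProposals π R ∧ Prefers (ρ a) q p) := by
  simp [daStep]

lemma subset_daStep : R ⊆ daStep π ρ R :=
  Finset.subset_union_left

lemma exists_mem_daProposals {p : Fin N} {a : Fin K} (ha : (p, a) ∉ R) :
    ∃ b, (p, b) ∈ daProposals π R ∧ (b = a ∨ Prefers (π p) b a) := by
  obtain ⟨b, hb, hbest⟩ := exists_favourite (π p) (s := Finset.univ.filter fun b => (p, b) ∉ R)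
    ⟨a, by simpa using ha⟩
  simp only [Finset.mem_filter, Finset.mem_univ, true_and] at hb hbest
  refine ⟨b, mem_daProposals.2 ⟨hb, fun c hcb => ?_⟩, hbest a ha⟩
  by_contra hc
  obtain rfl | hbc := hbest c hc
  exacts [Prefers.irrefl hcb, Prefers.irrefl (hcb.trans hbc)]

lemma daProposals_unique {p : Fin N} {a b : Fin K} (ha : (p, a) ∈ daProposals π R)
    (hb : (p, b) ∈ daProposals π R) : a = b := by
  rw [mem_daProposals] at ha hb
  rcases prefers_trichotomy (π p) a b with hab | hab | hba
  · exact absurd (hb.2 _ hab) ha.1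
  · exact hab
  · exact absurd (ha.2 _ hba) hb.1

/-- Every player rejected according to `R` has lost its arm to a player that the arm prefers and
that still proposes to it: the invariant of deferred acceptance behind stability. -/
def RejectionsJustified (π : Fin N → Equiv.Perm (Fin K)) (ρ : Fin K → Equiv.Perm (Fin N))
    (R : Finset (MarketPair N K)) : Prop :=
  ∀ p a, (p, a) ∈ R → ∃ q, (q, a) ∈ daProposals π R ∧ Prefers (ρ a) q p

lemma exists_mem_daProposals_daStep {q : Fin N} {a : Fin K} (hq : (q, a) ∈ daProposals π R) :
    ∃ q', (q', a) ∈ daProposals π (daStep π ρ R) ∧ (q' = q ∨ Prefers (ρ a) q' q) := by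
  obtain ⟨q', hq', hbest⟩ := exists_favourite (ρ a)
    (s := Finset.univ.filter fun q => (q, a) ∈ daProposals π R) ⟨q, by simpa using hq⟩
  simp only [Finset.mem_filter, Finset.mem_univ, true_and] at hq' hbest
  have hR := mem_daProposals.1 hq'
  refine ⟨q', mem_daProposals.2 ⟨fun hrej => ?_, fun c hc => subset_daStep (hR.2 c hc)⟩,
    hbest q hq⟩
  obtain ⟨-, p, hp, hpq⟩ := (mem_daStep.1 hrej).resolve_left hR.1
  obtain rfl | hqp := hbest p hp
  exacts [Prefers.irrefl hpq, Prefers.irrefl (hpq.trans hqp)]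

lemma RejectionsJustified.daStep (hR : RejectionsJustified π ρ R) :
    RejectionsJustified π ρ (daStep π ρ R) := by
  intro p a hpa
  obtain ⟨q, hq, hqp⟩ : ∃ q, (q, a) ∈ daProposals π R ∧ Prefers (ρ a) q p :=
    (mem_daStep.1 hpa).elim (hR p a) And.right
  obtain ⟨q', hq', rfl | hbetter⟩ := exists_mem_daProposals_daStep (ρ := ρ) hq
  exacts [⟨q', hq', hqp⟩, ⟨q', hq', hbetter.trans hqp⟩]

lemma disjoint_daStep_of_isStable {m : Finset (MarketPair N K)} (hm : IsStable π ρ m)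
    (hR : Disjoint m R) : Disjoint m (daStep π ρ R) := by
  rw [Finset.disjoint_left] at hR ⊢
  rintro ⟨p, a⟩ hpa hrej
  obtain ⟨-, q, hq, hqp⟩ := (mem_daStep.1 hrej).resolve_left (hR hpa)
  have hpartner (q' : Fin N) (hq' : (q', a) ∈ m) : q' = p := by
    by_contra hne
    exact (hm.1 _ hq' _ hpa (by simp [hne])).2 rfl
  have hqa : (q, a) ∉ m := fun hqa => Prefers.irrefl (hpartner q hqa ▸ hqp)
  refine hm.2 q a ⟨hqa, fun b hb => ?_, fun q' hq' => hpartner q' hq' ▸ hqp⟩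
  rcases prefers_trichotomy (π q) a b with hab | rfl | hba
  · exact hab
  · exact absurd hb hqa
  · exact absurd ((mem_daProposals.1 hq).2 b hba) (hR hb)

lemma isMatching_daProposals_of_isFixedPt (hR : Function.IsFixedPt (daStep π ρ) R) :
    IsMatching (daProposals π R) := by
  have hkept {p q : Fin N} {a : Fin K} (hp : (p, a) ∈ daProposals π R)
      (hq : (q, a) ∈ daProposals π R) : ¬ Prefers (ρ a) q p := fun hqp => by
    have hrej : (p, a) ∈ daStep π ρ R := mem_daStep.2 (.inr ⟨hp, q, hq, hqp⟩)
    exact (mem_daProposals.1 hp).1 (hR ▸ hrej)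
  rintro ⟨p, a⟩ hp ⟨q, b⟩ hq hne
  refine ⟨?_, ?_⟩
  · rintro rfl
    exact hne (by rw [daProposals_unique hp hq])
  · rintro rfl
    rcases prefers_trichotomy (ρ a) p q with hpq | rfl | hqp
    exacts [hkept hq hp hpq, hne rfl, hkept hp hq hqp]

lemma RejectionsJustified.not_isBlockingPair (hR : RejectionsJustified π ρ R) (p : Fin N)
    (a : Fin K) : ¬ IsBlockingPair π ρ (daProposals π R) p a := by
  rintro ⟨hpa, hplayer, harm⟩
  by_cases hrej : (p, a) ∈ R
  · obtain ⟨q, hq, hqp⟩ := hR p a hrej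
    exact Prefers.irrefl (hqp.trans (harm q hq))
  · obtain ⟨b, hb, rfl | hba⟩ := exists_mem_daProposals (π := π) hrej
    exacts [hpa hb, Prefers.irrefl (hba.trans (hplayer b hb))]

lemma isFixedPt_iterate_of_card_le {α : Type*} [Fintype α] {f : Finset α → Finset α}
    (hf : ∀ s, s ⊆ f s) {n : ℕ} (hn : Fintype.card α ≤ n) (s : Finset α) :
    Function.IsFixedPt f (f^[n] s) := by
  have hsub (k : ℕ) : f^[k] s ⊆ f^[k + 1] s := by
    rw [Function.iterate_succ_apply']
    exact hf _
  have hstab (k : ℕ) (hk : (f^[k] s).card = (f^[k + 1] s).card) :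
      (f^[k + 1] s).card = (f^[k + 2] s).card := by
    have heq : f^[k] s = f^[k + 1] s := Finset.eq_of_subset_of_card_le (hsub k) hk.ge
    rw [Function.iterate_succ_apply' f k, Function.iterate_succ_apply' f (k + 1), ← heq]
  have hconst {k : ℕ} (hk : n ≤ k) : (f^[k] s).card = (f^[Fintype.card α] s).card :=
    Nat.stabilises_of_monotone (monotone_nat_of_le_succ fun k => Finset.card_le_card (hsub k))
      (fun k => Finset.card_le_univ _) hstab (hn.trans hk)
  rw [Function.IsFixedPt, ← Function.iterate_succ_apply' f]
  exact (Finset.eq_of_subset_of_card_le (hsub n)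
    ((hconst n.le_succ).trans (hconst le_rfl).symm).le).symm

lemma isPlayerOptimalStable_deferredAcceptance (π : Fin N → Equiv.Perm (Fin K))
    (ρ : Fin K → Equiv.Perm (Fin N)) : IsPlayerOptimalStable π ρ (deferredAcceptance π ρ) := by
  have hfix : Function.IsFixedPt (daStep π ρ) ((daStep π ρ)^[N * K] ∅) :=
    isFixedPt_iterate_of_card_le (fun _ => subset_daStep) (by simp) ∅
  have hjustified : RejectionsJustified π ρ ((daStep π ρ)^[N * K] ∅) :=
    Function.Iterate.rec (RejectionsJustified π ρ) (fun _ _ h => absurd h (Finset.notMem_empty _))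
      (fun _ h => h.daStep) _
  have hdisjoint (m) (hm : IsStable π ρ m) : Disjoint m ((daStep π ρ)^[N * K] ∅) :=
    Function.Iterate.rec (Disjoint m) (Finset.disjoint_empty_right m)
      (fun _ h => disjoint_daStep_of_isStable hm h) _
  exact ⟨⟨isMatching_daProposals_of_isFixedPt hfix, hjustified.not_isBlockingPair⟩,
    fun m hm p a hpa => exists_mem_daProposals (Finset.disjoint_left.1 (hdisjoint m hm) hpa)⟩

end DeferredAcceptance

/-! ### Degree-reducing sequences -/

section DegreeReducing

variable {N K : ℕ}

lemma exists_subset_mem_degreeReducingSets {S r : Finset (MarketPair N K)} (hr : r ⊆ S)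
    (hdeg : maxDegree (S \ r) < maxDegree S) : ∃ r' ⊆ r, r' ∈ degreeReducingSets S := by
  induction r using Finset.induction_on with
  | empty => simp at hdeg
  | insert x r hx ih =>
    rw [Finset.insert_subset_iff] at hr
    by_cases hlt : maxDegree (S \ r) < maxDegree S
    · obtain ⟨r', hr', hred⟩ := ih hr.2 hlt
      exact ⟨r', hr'.trans (Finset.subset_insert _ _), hred⟩
    · refine ⟨_, Finset.Subset.refl _, Finset.insert_subset_iff.2 hr, ?_⟩
      have hrestore : insert x (S \ insert x r) = S \ r := by
        rw [Finset.sdiff_insert, Finset.insert_erase (Finset.mem_sdiff.2 ⟨hr.1, hx⟩)]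
      have hinsert := maxDegree_insert_le x (S \ insert x r)
      rw [hrestore] at hinsert
      omega

lemma nonempty_of_mem_degreeReducingSets {S r : Finset (MarketPair N K)}
    (hr : r ∈ degreeReducingSets S) : r.Nonempty := by
  rw [Finset.nonempty_iff_ne_empty]
  rintro rfl
  simpa using hr.2

/-- Removing both sets lowers the degree by two, and putting `z` back raises it by at most one. -/
lemma exists_subset_erase_mem_degreeReducingSets {S r₁ r₂ : Finset (MarketPair N K)}
    (h₁ : r₁ ∈ degreeReducingSets S) (h₂ : r₂ ∈ degreeReducingSets (S \ r₁))
    (z : MarketPair N K) : ∃ r ⊆ (r₁ ∪ r₂).erase z, r ∈ degreeReducingSets S := by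
  have hsub : (r₁ ∪ r₂).erase z ⊆ S := (Finset.erase_subset _ _).trans
    (Finset.union_subset h₁.1 (h₂.1.trans Finset.sdiff_subset))
  refine exists_subset_mem_degreeReducingSets hsub ?_
  have hrestore : S \ (r₁ ∪ r₂).erase z ⊆ insert z ((S \ r₁) \ r₂) := by
    intro y
    simp only [Finset.mem_sdiff, Finset.mem_erase, Finset.mem_union, Finset.mem_insert]
    tauto
  have hinsert := (maxDegree_mono hrestore).trans (maxDegree_insert_le _ _)
  have hdeg₁ := h₁.2
  have hdeg₂ := h₂.2
  omega

/-- The pairs that are left after removal of the first `n` sets of a sequence: `remainingPairs`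
with a natural number as index, so that the end of the sequence is included. -/
def pairsAfter (r : Fin K → Finset (MarketPair N K)) (n : ℕ) : Finset (MarketPair N K) :=
  Finset.univ.filter fun x => ∀ i : Fin K, i.1 < n → x ∉ r i

lemma remainingPairs_eq (r : Fin K → Finset (MarketPair N K)) (i : Fin K) :
    remainingPairs r i = pairsAfter r i := by
  ext x
  simp [remainingPairs, pairsAfter]

lemma pairsAfter_sdiff (r : Fin K → Finset (MarketPair N K)) (i : Fin K) :
    pairsAfter r i \ r i = pairsAfter r (i + 1) := by
  ext x
  simp only [pairsAfter, Finset.mem_sdiff, Finset.mem_filter, Finset.mem_univ, true_and,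
    Order.lt_add_one_iff, le_iff_lt_or_eq, or_imp, forall_and, Fin.val_inj, forall_eq]

/-- The largest value of `t` on the `i`-th set of a sequence. -/
noncomputable def layerMax (t : MarketPair N K → ℝ) (r : Fin K → Finset (MarketPair N K))
    (i : Fin K) : ℝ :=
  sSup (t '' (r i : Set (MarketPair N K)))

variable {t : MarketPair N K → ℝ} {tie : MarketPair N K → ℕ} {r : Fin K → Finset (MarketPair N K)}

lemma le_layerMax {i : Fin K} {x : MarketPair N K} (hx : x ∈ r i) : t x ≤ layerMax t r i :=
  le_csSup ((r i).finite_toSet.image t).bddAbove ⟨x, hx, rfl⟩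

lemma card_filter_range_lt_le {y : ℝ} (hy : 0 ≤ y) (T : ℕ) :
    (((Finset.range T).filter fun n : ℕ => (n : ℝ) < y).card : ℝ) ≤ y + 1 := by
  have hsub : ((Finset.range T).filter fun n : ℕ => (n : ℝ) < y) ⊆ Finset.range ⌈y⌉₊ :=
    fun n hn => Finset.mem_range.2 (Nat.lt_ceil.2 (Finset.mem_filter.1 hn).2)
  have hcard := Finset.card_le_card hsub
  rw [Finset.card_range] at hcard
  exact (Nat.cast_le.2 hcard).trans (Nat.ceil_lt_add_one hy).le

namespace IsDegreeReducingSequence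

lemma mem (h : IsDegreeReducingSequence t tie r) (i : Fin K) :
    r i ∈ degreeReducingSets (pairsAfter r i) :=
  remainingPairs_eq r i ▸ (h i).1

lemma maxDegree_pairsAfter_add (h : IsDegreeReducingSequence t tie r) {n : ℕ} (hn : n ≤ K) :
    maxDegree (pairsAfter r n) + n = maxDegree (Finset.univ : Finset (MarketPair N K)) := by
  induction n with
  | zero => simp [pairsAfter]
  | succ n ih =>
    have hdeg : maxDegree (pairsAfter r n) = maxDegree (pairsAfter r (n + 1)) + 1 :=
      pairsAfter_sdiff r ⟨n, hn⟩ ▸ (h.mem ⟨n, hn⟩).2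
    rw [← ih (Nat.le_of_succ_le hn), hdeg]
    ring

lemma maxDegree_pairsAfter_le (h : IsDegreeReducingSequence t tie r) (hNK : N ≤ K) {n : ℕ}
    (hn : n ≤ K) : maxDegree (pairsAfter r n) ≤ K - n := by
  have hadd := h.maxDegree_pairsAfter_add hn
  have huniv := maxDegree_le_max (Finset.univ : Finset (MarketPair N K))
  rw [max_eq_left hNK] at huniv
  omega

lemma exists_le_succ (h : IsDegreeReducingSequence t tie r) (htie : Function.Injective tie)
    {i j : Fin K} (hij : j.1 = i.1 + 1) : ∃ y ∈ r j, ∀ x ∈ r i, t x ≤ t y := by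
  obtain ⟨z, hz, hmax⟩ := (r i).exists_max_image (fun y => toLex (t y, tie y))
    (nonempty_of_mem_degreeReducingSets (h.mem i))
  have hj : r j ∈ degreeReducingSets (pairsAfter r i \ r i) := by
    rw [pairsAfter_sdiff, ← hij]
    exact h.mem j
  obtain ⟨r', hr', hred⟩ := exists_subset_erase_mem_degreeReducingSets (h.mem i) hj z
  obtain ⟨y, hy, hle⟩ := (h i).2 r' (remainingPairs_eq r i ▸ hred)
  obtain ⟨hyz, hy⟩ := Finset.mem_erase.1 (hr' hy)
  have hyi : y ∉ r i := fun hyi => hyz <| htie <|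
    congrArg Prod.snd (toLex.injective ((hmax y hyi).antisymm (hle z hz)))
  exact ⟨y, (Finset.mem_union.1 hy).resolve_left hyi,
    fun x hx => Prod.Lex.monotone_fst _ _ (hle x hx)⟩

lemma monotone_layerMax (h : IsDegreeReducingSequence t tie r) (htie : Function.Injective tie) :
    Monotone (layerMax t r) := by
  cases K with
  | zero => exact fun i => i.elim0
  | succ n =>
    refine Fin.monotone_iff_le_succ.2 fun i => ?_
    obtain ⟨y, hy, hle⟩ := h.exists_le_succ htie (i := i.castSucc) (j := i.succ) (by simp)
    refine csSup_le ((nonempty_of_mem_degreeReducingSets (h.mem _)).to_set.image t) ?_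
    rintro _ ⟨x, hx, rfl⟩
    exact (hle x hx).trans (le_layerMax hy)

lemma maxDegree_le_card (h : IsDegreeReducingSequence t tie r) (htie : Function.Injective tie)
    (hNK : N ≤ K) {S : Finset (MarketPair N K)} {θ : ℝ} (hS : ∀ x ∈ S, θ < t x) :
    maxDegree S ≤ (Finset.univ.filter fun i => θ < layerMax t r i).card := by
  set n := (Finset.univ.filter fun i => layerMax t r i ≤ θ).card
  have hcompl : n + (Finset.univ.filter fun i => θ < layerMax t r i).card = K := by
    simpa using Finset.card_filter_add_card_filter_not (s := (Finset.univ : Finset (Fin K)))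
      fun i => layerMax t r i ≤ θ
  have hsub : S ⊆ pairsAfter r n := by
    refine fun x hx => Finset.mem_filter.2 ⟨Finset.mem_univ x, fun i hi hxi => ?_⟩
    have hle : layerMax t r i ≤ θ :=
      (Tuple.lt_card_le_iff_apply_le_of_monotone (h.monotone_layerMax htie)).1 hi
    exact (hS x hx).not_ge ((le_layerMax hxi).trans hle)
  calc maxDegree S ≤ maxDegree (pairsAfter r n) := maxDegree_mono hsub
    _ ≤ K - n := h.maxDegree_pairsAfter_le hNK (by omega)
    _ = (Finset.univ.filter fun i => θ < layerMax t r i).card := by omega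

lemma sum_maxDegree_le (h : IsDegreeReducingSequence t tie r) (htie : Function.Injective tie)
    (hNK : N ≤ K) {c : ℝ} (hc : 0 < c) (ht : ∀ x, 0 ≤ t x) {A : ℕ → Finset (MarketPair N K)}
    (hA : ∀ n, ∀ x ∈ A n, (n : ℝ) < c * t x) (T : ℕ) :
    ∑ n ∈ Finset.range T, (maxDegree (A n) : ℝ) ≤ ∑ i, (c * layerMax t r i + 1) := by
  have hlayers (n : ℕ) : maxDegree (A n) ≤
      (Finset.univ.filter fun i => (n : ℝ) < c * layerMax t r i).card := by
    simp only [← div_lt_iff₀' hc]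
    exact h.maxDegree_le_card htie hNK fun x hx => (div_lt_iff₀' hc).2 (hA n x hx)
  have hnonneg (i : Fin K) : 0 ≤ c * layerMax t r i :=
    mul_nonneg hc.le (Real.sSup_nonneg (by rintro _ ⟨x, -, rfl⟩; exact ht x))
  calc ∑ n ∈ Finset.range T, (maxDegree (A n) : ℝ)
      ≤ ∑ n ∈ Finset.range T,
          ((Finset.univ.filter fun i => (n : ℝ) < c * layerMax t r i).card : ℝ) :=
        Finset.sum_le_sum fun n _ => Nat.cast_le.2 (hlayers n)
    _ = ∑ i, (((Finset.range T).filter fun n : ℕ => (n : ℝ) < c * layerMax t r i).card : ℝ) := by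
        exact_mod_cast Finset.sum_card_bipartiteAbove_eq_sum_card_bipartiteBelow
          fun (n : ℕ) i => (n : ℝ) < c * layerMax t r i
    _ ≤ ∑ i, (c * layerMax t r i + 1) :=
        Finset.sum_le_sum fun i _ => card_filter_range_lt_le (hnonneg i) T

end IsDegreeReducingSequence

end DegreeReducing

/-! ### Confidence radii and sample bounds -/

section SampleBounds

variable {N K : ℕ} {v : Fin N → Fin K → ℝ} {δ : ℝ}

lemma antitoneOn_log_mul_sq_div {c : ℝ} (hc : Real.exp 2 ≤ c) :
    AntitoneOn (fun y : ℝ => Real.log (c * y ^ 2) / (2 * y)) (Set.Ici 1) := by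
  have hexp : Real.exp 1 ≤ √c := Real.le_sqrt_of_sq_le (by rwa [← Real.exp_nat_mul, mul_one])
  have hc0 : 0 < √c := (Real.exp_pos 1).trans_le hexp
  have hrescale (y : ℝ) :
      Real.log (c * y ^ 2) / (2 * y) = √c * (Real.log (√c * y) / (√c * y)) := by
    have hsq : c * y ^ 2 = (√c * y) ^ 2 := by
      rw [mul_pow, Real.sq_sqrt (Real.sqrt_pos.1 hc0).le]
    rw [hsq, Real.log_pow, Nat.cast_two, mul_div_mul_left _ _ two_ne_zero, ← mul_div_assoc,
      mul_div_mul_left _ _ hc0.ne']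
  have hmem {y : ℝ} (hy : 1 ≤ y) : Real.exp 1 ≤ √c * y :=
    hexp.trans (le_mul_of_one_le_right hc0.le hy)
  intro x hx y hy hxy
  simp only [hrescale]
  exact mul_le_mul_of_nonneg_left
    (Real.log_div_self_antitoneOn (hmem hx) (hmem hy) (by gcongr)) hc0.le

lemma two_le_mul_div (hN : 1 ≤ N) (hK : 2 ≤ K) (hδ : 0 < δ) (hδ1 : δ ≤ 1) :
    2 ≤ (K : ℝ) * N / δ := by
  have hKN : (2 : ℝ) ≤ K * N := by exact_mod_cast Nat.mul_le_mul hK hN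
  exact hKN.trans (le_div_self (by positivity) hδ hδ1)

lemma confRadius_eq (N K : ℕ) (δ : ℝ) (t : ℕ) :
    confRadius N K δ t = √(Real.log (4 * (K * N / δ) * (t : ℝ) ^ 2) / (2 * t)) := by
  rw [confRadius]
  congr 3
  ring

lemma antitone_confRadius_succ (hN : 1 ≤ N) (hK : 2 ≤ K) (hδ : 0 < δ) (hδ1 : δ ≤ 1) :
    Antitone fun t => confRadius N K δ (t + 1) := by
  have hexp : Real.exp 2 ≤ 4 * (K * N / δ) := by
    have he : Real.exp 2 = Real.exp 1 ^ 2 := by rw [← Real.exp_nat_mul]; norm_num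
    nlinarith [two_le_mul_div hN hK hδ hδ1, Real.exp_one_lt_d9, Real.exp_pos 1]
  intro s t hst
  simp only [confRadius_eq]
  exact Real.sqrt_le_sqrt (antitoneOn_log_mul_sq_div hexp (by simp) (by simp) (by simpa using hst))

lemma log_div_lt_sq_of_le {b g t : ℝ} (hb : 2 ≤ b) (hg : 0 < g) (hg1 : g ≤ 1)
    (ht : 256 * (Real.log (b / g) / g ^ 2) ≤ t) :
    Real.log (4 * b * t ^ 2) / (2 * t) < (g / 4) ^ 2 := by
  have hlog2 := Real.log_two_gt_d9
  have hlogx : Real.log 2 ≤ Real.log (b / g) :=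
    Real.log_le_log two_pos (hb.trans (le_div_self (by linarith) hg hg1))
  obtain ⟨s, rfl⟩ : ∃ s, t = s / g ^ 2 := ⟨t * g ^ 2, by field_simp⟩
  have hs : 256 * Real.log (b / g) ≤ s := by
    rwa [← mul_div_assoc, div_le_div_iff_of_pos_right (by positivity)] at ht
  have hs0 : 0 < s := by linarith
  have hpow : 4 * b * (s / g ^ 2) ^ 2 ≤ ((b / g) ^ 2 * s) ^ 2 :=
    calc 4 * b * (s / g ^ 2) ^ 2 ≤ b ^ 3 * b * (s / g ^ 2) ^ 2 := by
          gcongr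
          nlinarith [pow_le_pow_left₀ zero_le_two hb 3]
      _ = ((b / g) ^ 2 * s) ^ 2 := by field_simp
  have hlog : Real.log (4 * b * (s / g ^ 2) ^ 2) ≤ 4 * Real.log (b / g) + 2 * Real.log s := by
    refine (Real.log_le_log (by positivity) hpow).trans_eq ?_
    rw [Real.log_pow, Real.log_mul (by positivity) hs0.ne', Real.log_pow]
    push_cast
    ring
  have hlogs : Real.log s ≤ s / 32 - 1 + 5 * Real.log 2 := by
    have htangent := Real.log_le_sub_one_of_pos (show 0 < s / 2 ^ 5 by positivity)
    rw [Real.log_div hs0.ne' (by positivity), Real.log_pow] at htangent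
    push_cast at htangent
    linarith
  have hmain : 8 * Real.log (4 * b * (s / g ^ 2) ^ 2) < s := by
    linarith [Real.log_two_lt_d9]
  calc Real.log (4 * b * (s / g ^ 2) ^ 2) / (2 * (s / g ^ 2)) < s / 8 / (2 * (s / g ^ 2)) := by
        gcongr
        linarith [hmain]
    _ = (g / 4) ^ 2 := by
        field_simp
        norm_num

lemma minGap_le {p : Fin N} {a b : Fin K} (hab : b ≠ a) : minGap v (p, a) ≤ |v p a - v p b| :=
  ciInf_le (f := fun b : {b : Fin K // b ≠ a} => |v p a - v p b|)
    ⟨0, by rintro _ ⟨b, rfl⟩; exact abs_nonneg _⟩ ⟨b, hab⟩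

lemma minGap_mem_Ioc (hK : 2 ≤ K) (hinj : ∀ p, Function.Injective (v p))
    (hv : ∀ p a, v p a ∈ Set.Icc (0 : ℝ) 1) (x : MarketPair N K) :
    minGap v x ∈ Set.Ioc (0 : ℝ) 1 := by
  have : Nontrivial (Fin K) := Fin.nontrivial_iff_two_le.2 hK
  have : Nonempty {b : Fin K // b ≠ x.2} := nonempty_subtype.2 (exists_ne x.2)
  obtain ⟨⟨b, hb⟩, hmin⟩ := exists_eq_ciInf_of_finite
    (f := fun b : {b : Fin K // b ≠ x.2} => |v x.1 x.2 - v x.1 b|)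
  rw [minGap, ← hmin]
  exact ⟨abs_pos.2 (sub_ne_zero.2 ((hinj x.1).ne hb.symm)),
    Real.dist_le_of_mem_Icc_01 (hv x.1 x.2) (hv x.1 b)⟩

lemma log_two_le_sampleBound (hK : 2 ≤ K) (hδ : 0 < δ) (hδ1 : δ ≤ 1)
    (hinj : ∀ p, Function.Injective (v p)) (hv : ∀ p a, v p a ∈ Set.Icc (0 : ℝ) 1)
    (x : MarketPair N K) : Real.log 2 ≤ sampleBound δ v x := by
  obtain ⟨hgap, hgap1⟩ := minGap_mem_Ioc hK hinj hv x
  have hKN := two_le_mul_div x.1.pos hK hδ hδ1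
  have hlog : Real.log 2 ≤ Real.log (K * N / δ / minGap v x) :=
    Real.log_le_log two_pos (hKN.trans (le_div_self (by linarith) hgap hgap1))
  rw [sampleBound, ← div_div]
  exact hlog.trans (le_div_self ((Real.log_nonneg one_le_two).trans hlog) (by positivity)
    (pow_le_one₀ hgap.le hgap1))

lemma four_mul_confRadius_lt_minGap (hK : 2 ≤ K) (hδ : 0 < δ) (hδ1 : δ ≤ 1)
    (hinj : ∀ p, Function.Injective (v p)) (hv : ∀ p a, v p a ∈ Set.Icc (0 : ℝ) 1)
    {x : MarketPair N K} {t : ℕ} (ht : 256 * sampleBound δ v x ≤ t) :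
    4 * confRadius N K δ t < minGap v x := by
  obtain ⟨hgap, hgap1⟩ := minGap_mem_Ioc hK hinj hv x
  rw [sampleBound, ← div_div] at ht
  have hradius : confRadius N K δ t < minGap v x / 4 := by
    rw [confRadius_eq, Real.sqrt_lt' (by positivity)]
    exact log_div_lt_sq_of_le (two_le_mul_div x.1.pos hK hδ hδ1) hgap hgap1 ht
  linarith

end SampleBounds

/-! ### Runs of the elimination algorithm -/

section ElimRun

variable {N K : ℕ} {δ : ℝ} {cover : Finset (MarketPair N K) → Finset (Finset (MarketPair N K))}
  {x : ℕ → Fin N → Fin K → ℝ} {t : ℕ} {p : Fin N} {a b : Fin K}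

lemma Icc_sub_add_inter_nonempty_iff {c d ε : ℝ} (hε : 0 ≤ ε) :
    (Set.Icc (c - ε) (c + ε) ∩ Set.Icc (d - ε) (d + ε)).Nonempty ↔ |c - d| ≤ 2 * ε := by
  rw [Set.Icc_inter_Icc, Set.nonempty_Icc, sup_le_iff, le_inf_iff, le_inf_iff, abs_le]
  constructor
  · rintro ⟨⟨-, hcd⟩, hdc, -⟩
    constructor <;> linarith
  · rintro ⟨hdc, hcd⟩
    refine ⟨⟨?_, ?_⟩, ?_, ?_⟩ <;> linarith

/-- The mean of the rewards `x s p a` of the rounds `s = 1, …, t`. -/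
noncomputable def rewardAverage (x : ℕ → Fin N → Fin K → ℝ) (t : ℕ) (p : Fin N) (a : Fin K) : ℝ :=
  (∑ s ∈ Finset.range t, x (s + 1) p a) / t

lemma elimRun_succ_of_active_nonempty (h : (elimRun δ cover x t).active.Nonempty) :
    elimRun δ cover x (t + 1) = elimRemove (confRadius N K δ (t + 1))
      (elimSample (cover (elimRun δ cover x t).active) (x (t + 1)) (elimRun δ cover x t)) := by
  simp [elimRun, h.ne_empty]

lemma elimRun_succ_of_active_eq_empty (h : (elimRun δ cover x t).active = ∅) :
    elimRun δ cover x (t + 1) = elimRun δ cover x t := by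
  simp [elimRun, h]

lemma active_elimRun_antitone : Antitone fun t => (elimRun δ cover x t).active := by
  refine antitone_nat_of_succ_le fun t => ?_
  obtain hempty | hne := (elimRun δ cover x t).active.eq_empty_or_nonempty
  · rw [elimRun_succ_of_active_eq_empty hempty]
  · rw [elimRun_succ_of_active_nonempty hne]
    exact Finset.filter_subset _ _

lemma numSamples_and_rewardSum_of_mem_active (h : (p, a) ∈ (elimRun δ cover x t).active) :
    (elimRun δ cover x t).numSamples p a = t ∧
      (elimRun δ cover x t).rewardSum p a = ∑ s ∈ Finset.range t, x (s + 1) p a := by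
  induction t with
  | zero => simp [elimRun, elimInit]
  | succ t ih =>
    have hprev := active_elimRun_antitone t.le_succ h
    obtain ⟨hnum, hsum⟩ := ih hprev
    rw [elimRun_succ_of_active_nonempty ⟨_, hprev⟩]
    simp [elimRemove, elimSample, hprev, hnum, hsum, Finset.sum_range_succ]

lemma estimate_elimSample (h : (p, a) ∈ (elimRun δ cover x t).active)
    (M : Finset (Finset (MarketPair N K))) :
    (elimSample M (x (t + 1)) (elimRun δ cover x t)).estimate p a =
      rewardAverage x (t + 1) p a := by
  obtain ⟨hnum, hsum⟩ := numSamples_and_rewardSum_of_mem_active h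
  simp [ElimState.estimate, rewardAverage, elimSample, h, hnum, hsum, Finset.sum_range_succ]

lemma estimate_elimRun_succ_of_mem (h : (p, a) ∈ (elimRun δ cover x t).active) :
    (elimRun δ cover x (t + 1)).estimate p a = rewardAverage x (t + 1) p a := by
  rw [elimRun_succ_of_active_nonempty ⟨_, h⟩]
  exact estimate_elimSample h (cover (elimRun δ cover x t).active)

lemma estimate_elimRun_succ_of_notMem (h : (p, a) ∉ (elimRun δ cover x t).active) :
    (elimRun δ cover x (t + 1)).estimate p a = (elimRun δ cover x t).estimate p a := by
  obtain hempty | hne := (elimRun δ cover x t).active.eq_empty_or_nonempty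
  · rw [elimRun_succ_of_active_eq_empty hempty]
  · rw [elimRun_succ_of_active_nonempty hne]
    simp [elimRemove, elimSample, h, ElimState.estimate]

lemma mem_active_elimRun_succ :
    (p, a) ∈ (elimRun δ cover x (t + 1)).active ↔ (p, a) ∈ (elimRun δ cover x t).active ∧
      ∃ j, j ≠ a ∧ (p, j) ∈ (elimRun δ cover x t).active ∧
        |rewardAverage x (t + 1) p a - rewardAverage x (t + 1) p j| ≤
          2 * confRadius N K δ (t + 1) := by
  obtain hempty | hne := (elimRun δ cover x t).active.eq_empty_or_nonempty
  · simp [elimRun_succ_of_active_eq_empty hempty, hempty]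
  · rw [elimRun_succ_of_active_nonempty hne]
    simp only [elimRemove, Finset.mem_filter]
    refine and_congr_right fun ha => ?_
    push Not
    refine exists_congr fun j => and_congr_right fun _ => and_congr_right fun hj => ?_
    rw [ElimState.confInterval, ElimState.confInterval, estimate_elimSample ha,
      estimate_elimSample hj]
    exact Icc_sub_add_inter_nonempty_iff (Real.sqrt_nonneg _)

lemma exists_estimate_eq_rewardAverage (h : (p, a) ∉ (elimRun δ cover x t).active) :
    ∃ s, (p, a) ∈ (elimRun δ cover x s).active ∧ (p, a) ∉ (elimRun δ cover x (s + 1)).active ∧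
      (elimRun δ cover x t).estimate p a = rewardAverage x (s + 1) p a := by
  induction t with
  | zero => simp [elimRun, elimInit] at h
  | succ t ih =>
    by_cases hprev : (p, a) ∈ (elimRun δ cover x t).active
    · exact ⟨t, hprev, h, estimate_elimRun_succ_of_mem hprev⟩
    · rw [estimate_elimRun_succ_of_notMem hprev]
      exact ih hprev

lemma numMatchings_elimRun_le (hcover : ∀ S, IsMinimalMatchingCover S (cover S)) (T : ℕ) :
    (elimRun δ cover x T).numMatchings ≤
      ∑ t ∈ Finset.range T, maxDegree (elimRun δ cover x t).active := by
  induction T with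
  | zero => simp [elimRun, elimInit]
  | succ T ih =>
    rw [Finset.sum_range_succ]
    obtain hempty | hne := (elimRun δ cover x T).active.eq_empty_or_nonempty
    · rw [elimRun_succ_of_active_eq_empty hempty]
      exact ih.trans (Nat.le_add_right _ _)
    · rw [elimRun_succ_of_active_nonempty hne]
      exact Nat.add_le_add ih (hcover _).card_le_maxDegree

lemma two_mul_confRadius_lt_abs_sub (h : (p, a) ∈ (elimRun δ cover x t).active)
    (h' : (p, a) ∉ (elimRun δ cover x (t + 1)).active) (hab : b ≠ a)
    (hb : (p, b) ∈ (elimRun δ cover x t).active) :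
    2 * confRadius N K δ (t + 1) <
      |rewardAverage x (t + 1) p a - rewardAverage x (t + 1) p b| := by
  by_contra! hle
  exact h' (mem_active_elimRun_succ.2 ⟨h, b, hab, hb, hle⟩)

lemma add_two_mul_lt_of_abs_sub_le {y z y' z' ε : ℝ} (hy : |y' - y| ≤ ε) (hz : |z' - z| ≤ ε)
    (hyz : y < z) (hε : 2 * ε < |y' - z'|) : y' + 2 * ε < z' := by
  rw [abs_le] at hy hz
  obtain hlt | hlt := lt_abs.1 hε <;> linarith

/-- The event on which the analysis of the algorithm rests: in every round `t = 1, 2, …`, the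
average of the rewards of each pair up to that round is within the confidence radius of its mean
`v p a`. -/
def AveragesAccurate (δ : ℝ) (x : ℕ → Fin N → Fin K → ℝ) (v : Fin N → Fin K → ℝ) : Prop :=
  ∀ t p a, |rewardAverage x (t + 1) p a - v p a| ≤ confRadius N K δ (t + 1)

namespace AveragesAccurate

variable {v : Fin N → Fin K → ℝ}

lemma minGap_le_of_mem_active (hx : AveragesAccurate δ x v)
    (h : (p, a) ∈ (elimRun δ cover x (t + 1)).active) :
    minGap v (p, a) ≤ 4 * confRadius N K δ (t + 1) := by
  obtain ⟨-, b, hb, -, hab⟩ := mem_active_elimRun_succ.1 h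
  calc minGap v (p, a) ≤ |v p a - v p b| := minGap_le hb
    _ = |-(rewardAverage x (t + 1) p a - v p a)
          + (rewardAverage x (t + 1) p a - rewardAverage x (t + 1) p b)
          + (rewardAverage x (t + 1) p b - v p b)| := by ring_nf
    _ ≤ confRadius N K δ (t + 1) + 2 * confRadius N K δ (t + 1) + confRadius N K δ (t + 1) := by
        refine (abs_add_three _ _ _).trans ?_
        rw [abs_neg]
        gcongr
        exacts [hx t p a, hx t p b]
    _ = 4 * confRadius N K δ (t + 1) := by ring

lemma lt_mul_sampleBound (hx : AveragesAccurate δ x v) (hK : 2 ≤ K) (hδ : 0 < δ) (hδ1 : δ ≤ 1)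
    (hinj : ∀ p, Function.Injective (v p)) (hv : ∀ p a, v p a ∈ Set.Icc (0 : ℝ) 1)
    {y : MarketPair N K} (hy : y ∈ (elimRun δ cover x t).active) :
    (t : ℝ) < 256 * sampleBound δ v y := by
  cases t with
  | zero =>
    have hpos := (Real.log_pos one_lt_two).trans_le (log_two_le_sampleBound hK hδ hδ1 hinj hv y)
    simpa using hpos
  | succ t =>
    by_contra! hle
    exact (four_mul_confRadius_lt_minGap hK hδ hδ1 hinj hv hle).not_ge
      (hx.minGap_le_of_mem_active hy)

lemma exists_active_eq_empty (hx : AveragesAccurate δ x v) (hδ : 0 < δ) (hδ1 : δ ≤ 1)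
    (hinj : ∀ p, Function.Injective (v p)) (hv : ∀ p a, v p a ∈ Set.Icc (0 : ℝ) 1) :
    ∃ T, (elimRun δ cover x T).active = ∅ := by
  obtain ⟨c, hc⟩ := Finite.bddAbove_range (sampleBound δ v)
  obtain ⟨T, hT⟩ := exists_nat_ge (256 * c)
  refine ⟨T + 1, Finset.eq_empty_of_forall_notMem fun ⟨p, a⟩ hy => ?_⟩
  obtain ⟨-, b, hb, -⟩ := mem_active_elimRun_succ.1 hy
  have hK : 2 ≤ K := Fin.nontrivial_iff_two_le.1 ⟨b, a, hb⟩
  have hlt := hx.lt_mul_sampleBound hK hδ hδ1 hinj hv hy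
  have hle := hc ⟨(p, a), rfl⟩
  push_cast at hlt
  linarith

/-- The arm of the two that is removed first has an average separated by `2 ε` from that of the
other one, and the average of the latter then remains on the same side, as later confidence radii
are at most `ε`. -/
lemma estimate_lt_estimate (hx : AveragesAccurate δ x v) (hδ : 0 < δ) (hδ1 : δ ≤ 1)
    (hT : (elimRun δ cover x t).active = ∅) (hab : v p a < v p b) :
    (elimRun δ cover x t).estimate p a < (elimRun δ cover x t).estimate p b := by
  have hne : a ≠ b := fun h => hab.ne (h ▸ rfl)
  have hradius := antitone_confRadius_succ p.pos (Fin.nontrivial_iff_two_le.1 ⟨a, b, hne⟩) hδ hδ1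
  have hremoved (c) : (p, c) ∉ (elimRun δ cover x t).active := by simp [hT]
  obtain ⟨s, hs, hs', hestimate⟩ := exists_estimate_eq_rewardAverage (hremoved a)
  obtain ⟨u, hu, hu', hestimate'⟩ := exists_estimate_eq_rewardAverage (hremoved b)
  rw [hestimate, hestimate']
  obtain hsu | hus := le_total s u
  · have hsep := add_two_mul_lt_of_abs_sub_le (hx s p a) (hx s p b) hab
      (two_mul_confRadius_lt_abs_sub hs hs' hne.symm (active_elimRun_antitone hsu hu))
    linarith [abs_le.1 (hx s p b), abs_le.1 (hx u p b), hradius hsu]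
  · have hsep := add_two_mul_lt_of_abs_sub_le (hx u p a) (hx u p b) hab
      (abs_sub_comm (rewardAverage x (u + 1) p b) _ ▸
        two_mul_confRadius_lt_abs_sub hu hu' hne (active_elimRun_antitone hus hs))
    linarith [abs_le.1 (hx u p a), abs_le.1 (hx s p a), hradius hus]

lemma isPlayerOptimalStable_output (hx : AveragesAccurate δ x v) (hδ : 0 < δ) (hδ1 : δ ≤ 1)
    (hinj : ∀ p, Function.Injective (v p)) (hT : (elimRun δ cover x t).active = ∅)
    (ρ : Fin K → Equiv.Perm (Fin N)) :
    IsPlayerOptimalStable (fun p => argsortDesc (v p)) ρ ((elimRun δ cover x t).output ρ) := by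
  have horder (p a b) : v p a < v p b ↔
      (elimRun δ cover x t).estimate p a < (elimRun δ cover x t).estimate p b := by
    refine ⟨hx.estimate_lt_estimate hδ hδ1 hT, fun h => ?_⟩
    obtain hlt | heq | hgt := lt_trichotomy (v p a) (v p b)
    · exact hlt
    · exact absurd h (hinj p heq ▸ lt_irrefl _)
    · exact absurd h (hx.estimate_lt_estimate hδ hδ1 hT hgt).not_gt
  rw [funext fun p => argsortDesc_congr (horder p)]
  exact isPlayerOptimalStable_deferredAcceptance _ ρ

lemma numMatchings_le (hx : AveragesAccurate δ x v)
    (hcover : ∀ S, IsMinimalMatchingCover S (cover S)) (hNK : N ≤ K) (hK : 2 ≤ K) (hδ : 0 < δ)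
    (hδ1 : δ ≤ 1) (hinj : ∀ p, Function.Injective (v p)) (hv : ∀ p a, v p a ∈ Set.Icc (0 : ℝ) 1)
    {tie : MarketPair N K → ℕ} (htie : Function.Injective tie) {r : Fin K → Finset (MarketPair N K)}
    (hr : IsDegreeReducingSequence (sampleBound δ v) tie r) :
    ((elimRun δ cover x t).numMatchings : ℝ) ≤ 258 * ∑ i, layerMax (sampleBound δ v) r i := by
  have hlog (y) : 1 ≤ 2 * sampleBound δ v y := by
    linarith [log_two_le_sampleBound hK hδ hδ1 hinj hv y, Real.log_two_gt_d9]
  calc ((elimRun δ cover x t).numMatchings : ℝ)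
      ≤ ∑ n ∈ Finset.range t, (maxDegree (elimRun δ cover x n).active : ℝ) := by
        exact_mod_cast numMatchings_elimRun_le hcover t
    _ ≤ ∑ i, (256 * layerMax (sampleBound δ v) r i + 1) :=
        hr.sum_maxDegree_le htie hNK (by norm_num) (fun y => by linarith [hlog y])
          (fun _ _ => hx.lt_mul_sampleBound hK hδ hδ1 hinj hv) t
    _ ≤ ∑ i, 258 * layerMax (sampleBound δ v) r i := by
        refine Finset.sum_le_sum fun i _ => ?_
        obtain ⟨y, hy⟩ := nonempty_of_mem_degreeReducingSets (hr.mem i)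
        linarith [hlog y, le_layerMax (t := sampleBound δ v) hy]
    _ = 258 * ∑ i, layerMax (sampleBound δ v) r i := (Finset.mul_sum ..).symm

end AveragesAccurate

end ElimRun

/-! ### Concentration of the averages -/

section Concentration

lemma measureReal_le_abs_sum_range_le {Ω : Type*} [MeasurableSpace Ω] {μ : Measure Ω}
    {Y : ℕ → Ω → ℝ} {c : NNReal} (hindep : iIndepFun Y μ) (hY : ∀ i, HasSubgaussianMGF (Y i) c μ)
    (n : ℕ) {ε : ℝ} (hε : 0 ≤ ε) :
    μ.real {ω | ε ≤ |∑ i ∈ Finset.range n, Y i ω|} ≤ 2 * Real.exp (-ε ^ 2 / (2 * n * c)) := by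
  have : IsProbabilityMeasure μ := hindep.isProbabilityMeasure
  have hupper := HasSubgaussianMGF.measure_sum_range_ge_le_of_iIndepFun hindep
    (fun i _ => hY i) (n := n) hε
  have hlower := HasSubgaussianMGF.measure_sum_range_ge_le_of_iIndepFun
    (hindep.comp (fun _ y => -y) fun _ => measurable_neg) (fun i _ => (hY i).neg) (n := n) hε
  have hunion : {ω | ε ≤ |∑ i ∈ Finset.range n, Y i ω|} =
      {ω | ε ≤ ∑ i ∈ Finset.range n, Y i ω} ∪ {ω | ε ≤ ∑ i ∈ Finset.range n, -Y i ω} := by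
    ext ω
    simp [le_abs]
  rw [hunion, two_mul]
  exact (measureReal_union_le _ _).trans (add_le_add hupper hlower)

lemma exp_neg_two_mul_mul_confRadius_sq_le {N K t : ℕ} {δ : ℝ} (hN : 1 ≤ N) (hK : 1 ≤ K)
    (ht : 1 ≤ t) (hδ : 0 < δ) :
    Real.exp (-(2 * t * confRadius N K δ t ^ 2)) ≤ δ / (4 * K * N * (t : ℝ) ^ 2) := by
  have hlog : Real.log (4 * K * N * (t : ℝ) ^ 2 / δ) ≤ 2 * t * confRadius N K δ t ^ 2 := by
    rw [← div_le_iff₀' (by positivity)]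
    exact (Real.sqrt_le_iff.1 le_rfl).2
  calc Real.exp (-(2 * t * confRadius N K δ t ^ 2))
      ≤ Real.exp (-Real.log (4 * K * N * (t : ℝ) ^ 2 / δ)) := by gcongr
    _ = δ / (4 * K * N * (t : ℝ) ^ 2) := by
        rw [Real.exp_neg, Real.exp_log (by positivity), inv_div]

lemma tsum_ofReal_mul_one_div_sq_le {c : ℝ} (hc : 0 ≤ c) :
    ∑' t : ℕ, ENNReal.ofReal (c * (1 / ((t + 1 : ℕ) : ℝ) ^ 2)) ≤ ENNReal.ofReal (2 * c) := by
  have hsum : HasSum (fun t : ℕ => 1 / ((t + 1 : ℕ) : ℝ) ^ 2) (Real.pi ^ 2 / 6) := by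
    simpa using (hasSum_nat_add_iff' 1).2 hasSum_zeta_two
  have hpi : Real.pi ^ 2 / 6 ≤ 2 := by nlinarith [Real.pi_lt_d2, Real.pi_pos]
  rw [← ENNReal.ofReal_tsum_of_nonneg (fun t => by positivity) (hsum.mul_left c).summable,
    (hsum.mul_left c).tsum_eq, mul_comm 2]
  gcongr

variable {N K : ℕ} {Ω : Type*} [MeasurableSpace Ω] {μ : Measure Ω}
  {D : Fin N → Fin K → Measure ℝ} {X : ℕ → Fin N → Fin K → Ω → ℝ} {δ : ℝ}

namespace IsRewardProcess

lemma ae_mem_Icc (h : IsRewardProcess μ D X) (t : ℕ) (p : Fin N) (a : Fin K) :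
    ∀ᵐ ω ∂μ, X t p a ω ∈ Set.Icc (0 : ℝ) 1 := by
  refine ae_of_ae_map (h.measurable t p a).aemeasurable (p := (· ∈ Set.Icc (0 : ℝ) 1)) ?_
  rw [h.law]
  exact h.support p a

lemma integral_eq (h : IsRewardProcess μ D X) (t : ℕ) (p : Fin N) (a : Fin K) :
    μ[X t p a] = meanReward D p a := by
  rw [meanReward, ← h.law t p a]
  exact (integral_map (h.measurable t p a).aemeasurable aestronglyMeasurable_id).symm

lemma iIndepFun_sub (h : IsRewardProcess μ D X) (p : Fin N) (a : Fin K) :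
    iIndepFun (fun t ω => X (t + 1) p a ω - meanReward D p a) μ :=
  ((h.indep p a).precomp (add_left_injective 1)).comp (fun _ x => x - meanReward D p a)
    fun _ => measurable_id.sub_const _

variable [IsProbabilityMeasure μ]

lemma meanReward_mem_Icc (h : IsRewardProcess μ D X) (p : Fin N) (a : Fin K) :
    meanReward D p a ∈ Set.Icc (0 : ℝ) 1 := by
  rw [← h.integral_eq 0 p a]
  exact (convex_Icc 0 1).integral_mem isClosed_Icc (h.ae_mem_Icc 0 p a)
    (Integrable.of_mem_Icc 0 1 (h.measurable 0 p a).aemeasurable (h.ae_mem_Icc 0 p a))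

lemma hasSubgaussianMGF_sub (h : IsRewardProcess μ D X) (t : ℕ) (p : Fin N) (a : Fin K) :
    HasSubgaussianMGF (fun ω => X t p a ω - meanReward D p a) (1 / 4) μ := by
  have hoeffding :=
    hasSubgaussianMGF_of_mem_Icc (h.measurable t p a).aemeasurable (h.ae_mem_Icc t p a)
  rw [h.integral_eq] at hoeffding
  convert hoeffding using 1
  norm_num

lemma measure_confRadius_lt_le (h : IsRewardProcess μ D X) (hδ : 0 < δ) (p : Fin N) (a : Fin K)
    (t : ℕ) :
    μ {ω | confRadius N K δ (t + 1) <
        |rewardAverage (fun t p a => X t p a ω) (t + 1) p a - meanReward D p a|} ≤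
      ENNReal.ofReal (δ / (2 * K * N) * (1 / ((t + 1 : ℕ) : ℝ) ^ 2)) := by
  set n := t + 1
  set ε := confRadius N K δ n
  have hn : (0 : ℝ) < n := by positivity
  have hsubset : {ω | ε < |rewardAverage (fun t p a => X t p a ω) n p a - meanReward D p a|} ⊆
      {ω | n * ε ≤ |∑ i ∈ Finset.range n, (X (i + 1) p a ω - meanReward D p a)|} := by
    intro ω hω
    have hsum : ∑ i ∈ Finset.range n, (X (i + 1) p a ω - meanReward D p a) =
        n * (rewardAverage (fun t p a => X t p a ω) n p a - meanReward D p a) := by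
      rw [rewardAverage, Finset.sum_sub_distrib, Finset.sum_const, Finset.card_range,
        nsmul_eq_mul, mul_sub, mul_div_cancel₀ _ hn.ne']
    rw [Set.mem_ofPred_eq, hsum, abs_mul, abs_of_pos hn]
    exact mul_le_mul_of_nonneg_left (le_of_lt hω) hn.le
  rw [← ofReal_measureReal]
  refine ENNReal.ofReal_le_ofReal ?_
  calc _ ≤ _ := measureReal_mono hsubset
    _ ≤ 2 * Real.exp (-(n * ε) ^ 2 / (2 * n * (1 / 4 : NNReal))) :=
        measureReal_le_abs_sum_range_le (h.iIndepFun_sub p a)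
          (fun i => h.hasSubgaussianMGF_sub (i + 1) p a) n (mul_nonneg hn.le (Real.sqrt_nonneg _))
    _ = 2 * Real.exp (-(2 * n * ε ^ 2)) := by
        congr 2
        push_cast
        field_simp
        norm_num
    _ ≤ 2 * (δ / (4 * K * N * (n : ℝ) ^ 2)) := by
        gcongr
        exact exp_neg_two_mul_mul_confRadius_sq_le p.pos a.pos t.succ_pos hδ
    _ = δ / (2 * K * N) * (1 / (n : ℝ) ^ 2) := by
        field_simp
        norm_num

lemma measure_not_averagesAccurate_le (h : IsRewardProcess μ D X) (hδ : 0 < δ) :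
    μ {ω | ¬ AveragesAccurate δ (fun t p a => X t p a ω) (meanReward D)} ≤ ENNReal.ofReal δ := by
  have hunion : {ω | ¬ AveragesAccurate δ (fun t p a => X t p a ω) (meanReward D)} ⊆
      ⋃ x : MarketPair N K, ⋃ t : ℕ, {ω | confRadius N K δ (t + 1) <
        |rewardAverage (fun t p a => X t p a ω) (t + 1) x.1 x.2 - meanReward D x.1 x.2|} := by
    intro ω hω
    simp only [AveragesAccurate, Set.mem_ofPred_eq, not_forall, not_le] at hω
    obtain ⟨t, p, a, hω⟩ := hω
    exact Set.mem_iUnion₂.2 ⟨(p, a), t, hω⟩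
  calc _ ≤ _ := measure_mono hunion
    _ ≤ ∑ _x : MarketPair N K, ENNReal.ofReal (2 * (δ / (2 * K * N))) := by
        refine (measure_iUnion_fintype_le _ _).trans (Finset.sum_le_sum fun x _ => ?_)
        exact (measure_iUnion_le _).trans <|
          (ENNReal.tsum_le_tsum fun t => h.measure_confRadius_lt_le hδ x.1 x.2 t).trans
            (tsum_ofReal_mul_one_div_sq_le (by positivity))
    _ = ENNReal.ofReal (N * K / (N * K) * δ) := by
        rw [Finset.sum_const, nsmul_eq_mul, Finset.card_univ, Fintype.card_prod, Fintype.card_fin,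
          Fintype.card_fin, ← ENNReal.ofReal_natCast, ← ENNReal.ofReal_mul (by positivity)]
        congr 1
        push_cast
        ring
    _ ≤ ENNReal.ofReal δ := by
        gcongr
        exact mul_le_of_le_one_left hδ.le (div_self_le_one _)

lemma ofReal_one_sub_le_measure_averagesAccurate (h : IsRewardProcess μ D X) (hδ : 0 < δ) :
    ENNReal.ofReal (1 - δ) ≤
      μ {ω | AveragesAccurate δ (fun t p a => X t p a ω) (meanReward D)} := by
  rw [ENNReal.ofReal_sub _ hδ.le, ENNReal.ofReal_one, tsub_le_iff_right, ← measure_univ (μ := μ)]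
  exact (measure_univ_le_add_compl _).trans
    (add_le_add_right (h.measure_not_averagesAccurate_le hδ) _)

end IsRewardProcess

end Concentration

theorem theorem2 :
    ∃ C : ℝ, 0 < C ∧
      ∀ (N K : ℕ), N ≤ K →
      ∀ (ρ : Fin K → Equiv.Perm (Fin N))
        (cover : Finset (MarketPair N K) → Finset (Finset (MarketPair N K))),
        (∀ S, IsMinimalMatchingCover S (cover S)) →
      ∀ (Ω : Type*) [MeasurableSpace Ω] (μ : Measure Ω) [IsProbabilityMeasure μ]
        (D : Fin N → Fin K → Measure ℝ) (X : ℕ → Fin N → Fin K → Ω → ℝ),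
        IsRewardProcess μ D X →
        (∀ p, Function.Injective (meanReward D p)) →
      ∀ δ : ℝ, 0 < δ →
        ENNReal.ofReal (1 - δ) ≤
          μ {ω | ∃ T, (elimRun δ cover (fun t p a => X t p a ω) T).active = ∅ ∧
            IsPlayerOptimalStable (fun p => argsortDesc (meanReward D p)) ρ
              ((elimRun δ cover (fun t p a => X t p a ω) T).output ρ)} ∧
        (2 ≤ K →
          ∀ (tie : MarketPair N K → ℕ), Function.Injective tie →
          ∀ r : Fin K → Finset (MarketPair N K),
            IsDegreeReducingSequence (sampleBound δ (meanReward D)) tie r →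
            ENNReal.ofReal (1 - δ) ≤
              μ {ω | ∃ T, (elimRun δ cover (fun t p a => X t p a ω) T).active = ∅ ∧
                IsPlayerOptimalStable (fun p => argsortDesc (meanReward D p)) ρ
                  ((elimRun δ cover (fun t p a => X t p a ω) T).output ρ) ∧
                ((elimRun δ cover (fun t p a => X t p a ω) T).numMatchings : ℝ) ≤
                  C * ∑ s, sSup (sampleBound δ (meanReward D) '' (r s : Set (MarketPair N K)))}) := by
  refine ⟨258, by norm_num, fun N K hNK ρ cover hcover Ω _ μ _ D X hX hinj δ hδ => ?_⟩
  obtain hδ1 | hδ1 := lt_or_ge 1 δ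
  · simp [ENNReal.ofReal_of_nonpos (sub_nonpos.2 hδ1.le)]
  have hv := hX.meanReward_mem_Icc
  have haccurate := hX.ofReal_one_sub_le_measure_averagesAccurate hδ
  refine ⟨haccurate.trans (measure_mono fun ω hω => ?_), fun hK tie htie r hr =>
    haccurate.trans (measure_mono fun ω hω => ?_)⟩
  all_goals obtain ⟨T, hT⟩ := AveragesAccurate.exists_active_eq_empty hω hδ hδ1 hinj hv
  · exact ⟨T, hT, hω.isPlayerOptimalStable_output hδ hδ1 hinj hT ρ⟩
  · exact ⟨T, hT, hω.isPlayerOptimalStable_output hδ hδ1 hinj hT ρ,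
      hω.numMatchings_le hcover hNK hK hδ hδ1 hinj hv htie hr⟩
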